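/- **Setting.** Let $N,K\ge 1$, and write $[i:j]=\{i,\dots,j\}$ (empty if $i>j$). An $(N,K)$ private information retrieval (PIR) code consists of the following. There are $K$ messages $W_1,\dots,W_K$, each made of $L\ge 1$ symbols, all $KL$ symbols being i.i.d. uniform on a finite alphabet $\mathcal X$ with $|\mathcal X|\ge 2$; a random key $\mathbf F$ independent of $W_{1:K}$; for each server $n\in[1:N]$ a stored content $S_n$ in a finite set $\mathcal S_n$, a function of $W_{1:K}$; for each $k\in[1:K]$ and $n\in[1:N]$ a query $Q_n^{[k]}$ in a countable set $\mathcal Q_n$, a function of $\mathbf F$; and an answer $A_n^{[k]}=\varphi_n(Q_n^{[k]},S_n)\in\mathcal Y^{\ell_n}$, a word over a finite alphabet $\mathcal Y$ whose length $\ell_n=\ell_n(Q^{[k]}_n)$ is determined by the query and has finite expectation. It is required that for each $k$ the message $W_k$ is, with probability one, a function of $A^{[k]}_{1:N}$ and $Q^{[k]}_{1:N}$, and that $\Pr(Q^{[k]}_n=q)=\Pr(Q^{[k']}_n=q)$ for all $n$, all $k,k'$ and all $q\in\mathcal Q_n$. The storage and download costs of the code are $$\bar\alpha=\frac1{NL}\sum_{n=1}^N\log_{|\mathcal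 X|}|\mathcal S_n|,\qquad \bar\beta=\frac{\log_{|\mathcal X|}|\mathcal Y|}{NL}\sum_{n=1}^N\mathbb E(\ell_n)$$ ($\bar\beta$ does not depend on $k$, by privacy). A pair $(\alpha,\beta)\in\mathbb R^2$ is achievable if some $(N,K)$ PIR code has $\bar\alpha\le\alpha$ and $\bar\beta\le\beta$. **Proposition (Relaxed entropic LP).** For every achievable $(\alpha,\beta)$ and all $a_0,b_0\ge 0$, the number $a_0\alpha+b_0\beta$ is at least the optimal value (the infimum, in $[-\infty,\infty]$) of the following linear program in the real variables $x_k(a,b)$, $y_k(a,b)$, where $k\in[1:K]$ and $a,b\ge 0$ are integers with $a+b\le N$: $$\text{minimize } a_0\,y_1(1,0)+b_0\,y_1(0,1)$$ subject to 1. (Submodularity) for all $\mathcal A_1,\mathcal B_1,\mathcal A_2,\mathcal B_2\subseteq[1:N]$ with $\mathcal A_1\cap\mathcal B_1=\mathcal A_2\cap\mathcal B_2=\emptyset$, $$z(|\mathcal A_1|,|\mathcal B_1|)+z(|\mathcal A_2|,|\mathcal B_2|)\ \ge\ z\big(|\mathcal A_1\cup\mathcal A_2|,\,|(\mathcal B_1\cup\mathcal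 B_2)\setminus(\mathcal A_1\cup\mathcal A_2)|\big)+z\big(|\mathcal A_1\cap\mathcal A_2|,\,|\mathcal B_1\cap\mathcal B_2|+|\mathcal A_1\cap\mathcal B_2|+|\mathcal A_2\cap\mathcal B_1|\big)$$ for $z=x_k$, $k\in[1:K-1]$, and for $z=y_k$, $k\in[1:K]$; 2. (Monotonicity) $z(a,b)\ge z(a,b-1)$ for all $a\in[0:N-1]$, $b\in[1:N-a]$, for $z=x_k$, $k\in[1:K-1]$, and for $z=y_k$, $k\in[1:K]$; 3. (Decodability) $y_k(a,N-a)\ge 1+x_k(a,N-a)$ for $k\in[1:K]$, $a\in[0:N-1]$; 4. (Han's inequality) $y_k(0,b)\ge\frac bN\,y_k(0,N)$ for $k\in[1:K]$, $b\in[1:N-1]$; 5. (Privacy) $x_k(a,1)=y_{k+1}(a,1)$ for $k\in[1:K-1]$, $a\in[0:N-1]$; 6. (Invariance) $x_k(a,0)=y_{k+1}(a,0)$ for $k\in[1:K-1]$, $a\in[1:N]$; 7. (Boundary) $x_K(a,b)=0$ for $a\in[0:N]$, $b\in[0:N-a]$. The bound remains true if all variables are in addition required to be nonnegative (the variables stand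 for the normalized conditional entropies $H(S_{\mathcal A},A^{[k]}_{\mathcal B}\mid\mathbf F,W_{1:k})/L$ and $H(S_{\mathcal A},A^{[k]}_{\mathcal B}\mid\mathbf F,W_{1:k-1})/L$ with $|\mathcal A|=a$, $|\mathcal B|=b$, $\mathcal A\cap\mathcal B=\emptyset$, of a symmetrized code). Moreover, the number of distinct constraints of the program is $O(KN^8)$: there is a constant $C$ such that for all $N,K\ge1$ constraints 1–7 comprise at most $C\,K\,N^8$ distinct linear inequalities and equations. -/

import Mathlib

open MeasureTheory ProbabilityTheory

namespace PIR

/-- An `(N, K)` private information retrieval code, together with the probability space on which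
the messages and the random key live. Servers are indexed by `Fin N`, messages by `Fin K`. -/
structure Code (N K : ℕ) where
  /-- alphabet of the message symbols -/
  X : Type
  [fintypeX : Fintype X]
  [measurableSpaceX : MeasurableSpace X]
  [measurableSingletonX : MeasurableSingletonClass X]
  two_le_card : 2 ≤ Fintype.card X
  /-- number of symbols of each message -/
  L : ℕ
  L_pos : 0 < L
  /-- alphabet of the answer symbols -/
  Y : Type
  [fintypeY : Fintype Y]
  /-- alphabet of the content stored at server `n` -/
  Sto : Fin N → Type
  [fintypeSto : ∀ n, Fintype (Sto n)]
  /-- alphabet of the queries to server `n` (discrete) -/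
  Qry : Fin N → Type
  [countableQry : ∀ n, Countable (Qry n)]
  [measurableSpaceQry : ∀ n, MeasurableSpace (Qry n)]
  [measurableSingletonQry : ∀ n, MeasurableSingletonClass (Qry n)]
  /-- values of the random key -/
  Key : Type
  [measurableSpaceKey : MeasurableSpace Key]
  /-- the probability space -/
  Ω : Type
  [measurableSpaceΩ : MeasurableSpace Ω]
  P : Measure Ω
  [isProb : IsProbabilityMeasure P]
  /-- the messages `W_1, …, W_K`: all `K * L` symbols are i.i.d. uniform on `X` -/
  W : Ω → Fin K → Fin L → X
  measurable_W : Measurable W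
  uniform_W : ∀ w : Fin K → Fin L → X, P (W ⁻¹' {w}) = ((Fintype.card X : ENNReal) ^ (K * L))⁻¹
  /-- the random key, independent of the messages -/
  F : Ω → Key
  measurable_F : Measurable F
  indep : IndepFun F W P
  /-- the content of server `n` is a function of the messages -/
  store : ∀ n, (Fin K → Fin L → X) → Sto n
  /-- the query to server `n` when message `k` is wanted is a function of the key -/
  query : Fin K → ∀ n, Key → Qry n
  measurable_query : ∀ k n, Measurable (query k n)
  /-- the length of the answer of server `n` to a query -/
  len : ∀ n, Qry n → ℕ
  /-- the answer of server `n` is a word over `Y`, a function of the query and the content only -/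
  answer : ∀ n, (q : Qry n) → Sto n → (Fin (len n q) → Y)
  /-- the reconstruction of message `k` from the queries and the answers of all servers -/
  decode : Fin K → (q : ∀ n, Qry n) → (∀ n, Fin (len n (q n)) → Y) → (Fin L → X)
  /-- the wanted message is recovered with probability one -/
  correct : ∀ k, ∀ᵐ ω ∂P,
    decode k (fun n => query k n (F ω))
      (fun n => answer n (query k n (F ω)) (store n (W ω))) = W ω k
  /-- privacy: the law of the query to a single server does not depend on the wanted message -/
  privacy : ∀ n k k' (q : Qry n),
    P {ω | query k n (F ω) = q} = P {ω | query k' n (F ω) = q}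
  /-- answers have finite expected length -/
  integrable_len : ∀ k n, Integrable (fun ω => (len n (query k n (F ω)) : ℝ)) P

attribute [instance] Code.fintypeX Code.measurableSpaceX Code.measurableSingletonX Code.fintypeY
  Code.fintypeSto Code.countableQry Code.measurableSpaceQry Code.measurableSingletonQry
  Code.measurableSpaceKey Code.measurableSpaceΩ Code.isProb

namespace Code

variable {N K : ℕ}

/-- The operational normalized average storage cost
`(1 / (N L)) ∑ₙ log_{|X|} |𝒮ₙ|`. -/
noncomputable def storageCost (c : Code N K) : ℝ :=
  (1 / ((N : ℝ) * c.L)) * ∑ n, Real.logb (Fintype.card c.X) (Fintype.card (c.Sto n))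

/-- The operational normalized average download cost `(log_{|X|} |Y| / (N L)) ∑ₙ E(ℓₙ)` when
message `k` is wanted. -/
noncomputable def downloadCost (c : Code N K) (k : Fin K) : ℝ :=
  (Real.logb (Fintype.card c.X) (Fintype.card c.Y) / ((N : ℝ) * c.L)) *
    ∑ n, ∫ ω, (c.len n (c.query k n (c.F ω)) : ℝ) ∂c.P

/-- By privacy, the download cost does not depend on the wanted message. -/
theorem downloadCost_eq (c : Code N K) (k k' : Fin K) :
    c.downloadCost k = c.downloadCost k' := by
  unfold downloadCost
  congr 1
  refine Finset.sum_congr rfl fun n _ => ?_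
  have hm : ∀ j, Measurable fun ω => c.query j n (c.F ω) := fun j =>
    (c.measurable_query j n).comp c.measurable_F
  have hg : Measurable fun q : c.Qry n => (c.len n q : ℝ) := measurable_of_countable _
  have hmap : c.P.map (fun ω => c.query k n (c.F ω)) =
      c.P.map (fun ω => c.query k' n (c.F ω)) := by
    refine Measure.ext_of_singleton fun q => ?_
    rw [Measure.map_apply (hm k) (measurableSet_singleton q),
      Measure.map_apply (hm k') (measurableSet_singleton q)]
    exact c.privacy n k k' q
  rw [← integral_map (hm k).aemeasurable hg.aestronglyMeasurable, hmap,
    integral_map (hm k').aemeasurable hg.aestronglyMeasurable]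

end Code

/-- `(α, β)` is achievable with `N` servers and `K` messages if some code has storage cost at most
`α` and download cost at most `β`. -/
def Achievable (N K : ℕ) (α β : ℝ) : Prop :=
  ∃ c : Code N K, c.storageCost ≤ α ∧ ∀ k, c.downloadCost k ≤ β

/-- The variables `x_k(a, b)` and `y_k(a, b)` of the linear program. For given `N`, `K` only those
with `1 ≤ k ≤ K` and `a + b ≤ N` occur in it. -/
inductive Var : Type
  | x (k a b : ℕ) : Var
  | y (k a b : ℕ) : Var

/-- A linear inequality `∑ coeff i * v i ≥ const`, or, if `isEq` is true, the linear equation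
`∑ coeff i * v i = const`. -/
structure LinConstraint where
  isEq : Bool
  coeff : Var →₀ ℝ
  const : ℝ

/-- The assignment `v` of real values to the variables satisfies the constraint. -/
def LinConstraint.Holds (c : LinConstraint) (v : Var → ℝ) : Prop :=
  match c.isEq with
  | true => (c.coeff.sum fun i r => r * v i) = c.const
  | false => c.const ≤ c.coeff.sum fun i r => r * v i

/-- The linear form consisting of a single variable. -/
noncomputable def form (i : Var) : Var →₀ ℝ := Finsupp.single i 1

/-- The submodularity inequality for the family `z` of variables and two pairs of sets. -/
noncomputable def submodularity {N : ℕ} (z : ℕ → ℕ → Var) (A₁ B₁ A₂ B₂ : Finset (Fin N)) :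
    LinConstraint where
  isEq := false
  coeff := form (z A₁.card B₁.card) + form (z A₂.card B₂.card)
    - form (z (A₁ ∪ A₂).card ((B₁ ∪ B₂) \ (A₁ ∪ A₂)).card)
    - form (z (A₁ ∩ A₂).card ((B₁ ∩ B₂).card + (A₁ ∩ B₂).card + (A₂ ∩ B₁).card))
  const := 0

open Var in
/-- The constraints of the relaxed entropic linear program for `N` servers and `K` messages. -/
inductive IsConstraint (N K : ℕ) : LinConstraint → Prop
  | submodular_x (k : ℕ) (hk : 1 ≤ k ∧ k ≤ K - 1) (A₁ B₁ A₂ B₂ : Finset (Fin N))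
      (h₁ : A₁ ∩ B₁ = ∅) (h₂ : A₂ ∩ B₂ = ∅) :
      IsConstraint N K (submodularity (x k) A₁ B₁ A₂ B₂)
  | submodular_y (k : ℕ) (hk : 1 ≤ k ∧ k ≤ K) (A₁ B₁ A₂ B₂ : Finset (Fin N))
      (h₁ : A₁ ∩ B₁ = ∅) (h₂ : A₂ ∩ B₂ = ∅) :
      IsConstraint N K (submodularity (y k) A₁ B₁ A₂ B₂)
  | monotone_x (k a b : ℕ) (hk : 1 ≤ k ∧ k ≤ K - 1) (ha : a ≤ N - 1) (hb : 1 ≤ b ∧ b ≤ N - a) :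
      IsConstraint N K ⟨false, form (x k a b) - form (x k a (b - 1)), 0⟩
  | monotone_y (k a b : ℕ) (hk : 1 ≤ k ∧ k ≤ K) (ha : a ≤ N - 1) (hb : 1 ≤ b ∧ b ≤ N - a) :
      IsConstraint N K ⟨false, form (y k a b) - form (y k a (b - 1)), 0⟩
  | decodable (k a : ℕ) (hk : 1 ≤ k ∧ k ≤ K) (ha : a ≤ N - 1) :
      IsConstraint N K ⟨false, form (y k a (N - a)) - form (x k a (N - a)), 1⟩
  | han (k b : ℕ) (hk : 1 ≤ k ∧ k ≤ K) (hb : 1 ≤ b ∧ b ≤ N - 1) :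
      IsConstraint N K ⟨false, form (y k 0 b) - ((b : ℝ) / N) • form (y k 0 N), 0⟩
  | privacy (k a : ℕ) (hk : 1 ≤ k ∧ k ≤ K - 1) (ha : a ≤ N - 1) :
      IsConstraint N K ⟨true, form (x k a 1) - form (y (k + 1) a 1), 0⟩
  | invariance (k a : ℕ) (hk : 1 ≤ k ∧ k ≤ K - 1) (ha : 1 ≤ a ∧ a ≤ N) :
      IsConstraint N K ⟨true, form (x k a 0) - form (y (k + 1) a 0), 0⟩
  | boundary (a b : ℕ) (ha : a ≤ N) (hb : b ≤ N - a) :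
      IsConstraint N K ⟨true, form (x K a b), 0⟩

/-- The feasible assignments of the linear program. -/
def feasible (N K : ℕ) : Set (Var → ℝ) :=
  {v | ∀ c, IsConstraint N K c → c.Holds v}

/-- The objective function `a₀ y₁(1, 0) + b₀ y₁(0, 1)`. -/
def objective (a₀ b₀ : ℝ) (v : Var → ℝ) : ℝ :=
  a₀ * v (Var.y 1 1 0) + b₀ * v (Var.y 1 0 1)

/-- The optimal value of minimizing the objective function over a set of assignments, as an
extended real number. -/
noncomputable def optimum (s : Set (Var → ℝ)) (a₀ b₀ : ℝ) : EReal :=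
  ⨅ v ∈ s, (objective a₀ b₀ v : EReal)

end PIR

/-! Every code yields a feasible point of the program whose objective is at most `a₀ α + b₀ β`. The
key is independent of the messages, so fixing the queries leaves the messages uniform on a finite
set. Contents and answers are then functions of the messages, that is, partitions of this set, and
the Shannon inequalities needed are counting statements about partitions (`entropy_inf_add_le`,
`entropy_le_log_card`).

At fixed queries, submodularity holds because a content determines the answer of its server
(`condEntropy_submodular`). Decodability holds because the answers determine the wanted message,
which carries exactly one unit of normalized entropy (`condEntropy_of_decodable`). Integrating over
the key keeps these relations. Privacy enters only here: with at most one answer in the view, the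
integral depends only on the law of one query, hence not on the wanted message
(`keyEntropy_singleton`).

Averaging over all permutations of the servers leaves a quantity that depends only on the sizes of
the two sets (`sizeEntropy_card`). Submodularity then makes it concave in the number of answers,
which gives Han's inequality. At size one it is bounded by the storage and download costs.

The values obtained are nonnegative, so they bound the optimum with sign constraints, and therefore
the smaller optimum without them. The count of constraints comes from a parametrization by kind,
message index and eight sizes. -/

namespace PIR

/-! ### Entropy of partitions of a finite uniform space. -/

section Entropy

variable {Ω : Type*} [Fintype Ω]

open Classical in
/-- The equivalence class of a point, as a finset. -/
noncomputable def cls (r : Setoid Ω) (ω : Ω) : Finset Ω := Finset.univ.filter fun ω' => r ω ω'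

/-- The entropy of the partition into the classes of `r`, for the uniform law on `Ω`. -/
noncomputable def entropy (r : Setoid Ω) : ℝ :=
  (∑ ω, (Real.log (Fintype.card Ω) - Real.log (cls r ω).card)) / Fintype.card Ω

theorem mem_cls {r : Setoid Ω} {ω ω' : Ω} : ω' ∈ cls r ω ↔ r ω ω' := by
  classical
  simp [cls]

theorem card_cls_pos (r : Setoid Ω) (ω : Ω) : 0 < ((cls r ω).card : ℝ) := by
  exact_mod_cast Finset.card_pos.2 ⟨ω, mem_cls.2 (r.refl' ω)⟩

theorem cls_eq_of_rel {r : Setoid Ω} {ω ω' : Ω} (h : r ω ω') : cls r ω = cls r ω' := by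
  ext x
  rw [mem_cls, mem_cls]
  exact ⟨fun hx => r.trans' (r.symm' h) hx, fun hx => r.trans' h hx⟩

theorem entropy_le_of_le {r s : Setoid Ω} (h : r ≤ s) : entropy s ≤ entropy r := by
  unfold entropy
  gcongr with ω
  · exact card_cls_pos r ω
  · intro x hx
    exact mem_cls.2 (h (mem_cls.1 hx))

theorem entropy_nonneg (r : Setoid Ω) : 0 ≤ entropy r := by
  refine div_nonneg (Finset.sum_nonneg fun ω _ => sub_nonneg.2 ?_) (Nat.cast_nonneg _)
  refine Real.log_le_log (card_cls_pos r ω) ?_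
  exact_mod_cast Finset.card_le_univ _

theorem entropy_top [Nonempty Ω] : entropy (⊤ : Setoid Ω) = 0 := by
  have h : ∀ ω : Ω, cls (⊤ : Setoid Ω) ω = Finset.univ := fun ω => by
    ext x
    simp [mem_cls, Setoid.top_def]
  simp [entropy, h]

theorem sum_cls_inv (r : Setoid Ω) (ω : Ω) :
    ∑ ω' ∈ cls r ω, ((cls r ω').card : ℝ)⁻¹ = 1 := by
  have h : ∀ ω' ∈ cls r ω, ((cls r ω').card : ℝ)⁻¹ = ((cls r ω).card : ℝ)⁻¹ := fun ω' h' => by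
    rw [cls_eq_of_rel (mem_cls.1 h')]
  rw [Finset.sum_congr rfl h, Finset.sum_const, nsmul_eq_mul,
    mul_inv_cancel₀ (card_cls_pos r ω).ne']

-- Write the sizes of the `r`- and `s`-classes of `ω` as sums of indicators over `ω₁` and `ω₂`. For
-- fixed `ω₁, ω₂` the admissible `ω` are either none or one whole class of `r ⊓ s`, so the sum over
-- `ω` is at most the inverse size of a `t`-class, and it vanishes unless `t ω₁ ω₂`.
open Classical in
theorem sum_card_mul_card_div_le {r s t : Setoid Ω} (hr : r ≤ t) (hs : s ≤ t) :
    ∑ ω, ((cls r ω).card : ℝ) * (cls s ω).card *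
      (((cls (r ⊓ s) ω).card : ℝ)⁻¹ * ((cls t ω).card : ℝ)⁻¹) ≤ Fintype.card Ω := by
  have key : ∀ ω₁ ω₂ : Ω, ∑ ω, (if r ω ω₁ then (1 : ℝ) else 0) * (if s ω ω₂ then 1 else 0) *
      (((cls (r ⊓ s) ω).card : ℝ)⁻¹ * ((cls t ω).card : ℝ)⁻¹) ≤
      if t ω₁ ω₂ then ((cls t ω₁).card : ℝ)⁻¹ else 0 := by
    intro ω₁ ω₂
    by_cases hex : ∃ ω, r ω ω₁ ∧ s ω ω₂
    · obtain ⟨ω₀, h₁, h₂⟩ := hex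
      have ht : t ω₁ ω₂ := t.trans' (t.symm' (hr h₁)) (hs h₂)
      rw [if_pos ht]
      have hstep : ∀ ω, (if r ω ω₁ then (1 : ℝ) else 0) * (if s ω ω₂ then 1 else 0) *
          (((cls (r ⊓ s) ω).card : ℝ)⁻¹ * ((cls t ω).card : ℝ)⁻¹) =
          if ω ∈ cls (r ⊓ s) ω₀ then
            ((cls (r ⊓ s) ω).card : ℝ)⁻¹ * ((cls t ω₁).card : ℝ)⁻¹ else 0 := by
        intro ω
        by_cases hω : r ω ω₁ ∧ s ω ω₂
        · have hm : ω ∈ cls (r ⊓ s) ω₀ :=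
            mem_cls.2 ⟨r.trans' h₁ (r.symm' hω.1), s.trans' h₂ (s.symm' hω.2)⟩
          rw [if_pos hω.1, if_pos hω.2, if_pos hm, cls_eq_of_rel (hr hω.1)]
          ring
        · have hm : ω ∉ cls (r ⊓ s) ω₀ := fun hm =>
            hω ⟨r.trans' (r.symm' (mem_cls.1 hm).1) h₁, s.trans' (s.symm' (mem_cls.1 hm).2) h₂⟩
          rw [if_neg hm]
          rcases not_and_or.1 hω with h | h <;> simp [h]
      rw [Finset.sum_congr rfl fun ω _ => hstep ω, Finset.sum_ite_mem, Finset.univ_inter,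
        ← Finset.sum_mul, sum_cls_inv, one_mul]
    · rw [Finset.sum_eq_zero]
      · split_ifs
        · positivity
        · exact le_rfl
      · intro ω _
        rcases not_and_or.1 (not_exists.1 hex ω) with h | h <;> simp [h]
  have hcard : ∀ (u : Setoid Ω) (ω : Ω), ((cls u ω).card : ℝ) = ∑ ω', if u ω ω' then (1 : ℝ) else 0 :=
    fun u ω => by simp [cls]
  calc ∑ ω, ((cls r ω).card : ℝ) * (cls s ω).card *
      (((cls (r ⊓ s) ω).card : ℝ)⁻¹ * ((cls t ω).card : ℝ)⁻¹)
      = ∑ ω, ∑ ω₁, ∑ ω₂, (if r ω ω₁ then (1 : ℝ) else 0) * (if s ω ω₂ then 1 else 0) *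
      (((cls (r ⊓ s) ω).card : ℝ)⁻¹ * ((cls t ω).card : ℝ)⁻¹) := by
        refine Finset.sum_congr rfl fun ω _ => ?_
        rw [hcard r, hcard s, Finset.sum_mul_sum, Finset.sum_mul]
        exact Finset.sum_congr rfl fun _ _ => Finset.sum_mul _ _ _
    _ = ∑ ω₁, ∑ ω₂, ∑ ω, (if r ω ω₁ then (1 : ℝ) else 0) * (if s ω ω₂ then 1 else 0) *
      (((cls (r ⊓ s) ω).card : ℝ)⁻¹ * ((cls t ω).card : ℝ)⁻¹) := by
        rw [Finset.sum_comm]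
        exact Finset.sum_congr rfl fun _ _ => Finset.sum_comm
    _ ≤ ∑ ω₁, ∑ ω₂, if t ω₁ ω₂ then ((cls t ω₁).card : ℝ)⁻¹ else 0 :=
        Finset.sum_le_sum fun ω₁ _ => Finset.sum_le_sum fun ω₂ _ => key ω₁ ω₂
    _ = ∑ ω₁ : Ω, 1 := by
        refine Finset.sum_congr rfl fun ω₁ _ => ?_
        rw [← Finset.sum_filter, Finset.sum_const, nsmul_eq_mul]
        exact mul_inv_cancel₀ (card_cls_pos t ω₁).ne'
    _ = Fintype.card Ω := by simp

/-- Strong subadditivity of entropy. -/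
theorem entropy_inf_add_le {r s t : Setoid Ω} (hr : r ≤ t) (hs : s ≤ t) :
    entropy (r ⊓ s) + entropy t ≤ entropy r + entropy s := by
  -- This is `log x ≤ x - 1` for the ratio `x` of class sizes whose average
  -- `sum_card_mul_card_div_le` bounds by 1.
  have hlog : ∀ ω, 1 - ((cls r ω).card : ℝ) * (cls s ω).card *
      (((cls (r ⊓ s) ω).card : ℝ)⁻¹ * ((cls t ω).card : ℝ)⁻¹) ≤
      Real.log (cls (r ⊓ s) ω).card + Real.log (cls t ω).card
        - Real.log (cls r ω).card - Real.log (cls s ω).card := by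
    intro ω
    have h1 := card_cls_pos r ω
    have h2 := card_cls_pos s ω
    have h3 := card_cls_pos (r ⊓ s) ω
    have h4 := card_cls_pos t ω
    have := Real.log_le_sub_one_of_pos (x := ((cls r ω).card : ℝ) * (cls s ω).card *
      (((cls (r ⊓ s) ω).card : ℝ)⁻¹ * ((cls t ω).card : ℝ)⁻¹)) (by positivity)
    rw [Real.log_mul (by positivity) (by positivity), Real.log_mul h1.ne' h2.ne',
      Real.log_mul (by positivity) (by positivity), Real.log_inv, Real.log_inv] at this
    linarith
  have hsum := Finset.sum_le_sum fun ω (_ : ω ∈ Finset.univ) => hlog ω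
  have hle := sum_card_mul_card_div_le hr hs
  simp only [Finset.sum_sub_distrib, Finset.sum_add_distrib] at hsum
  simp only [Finset.sum_const, Finset.card_univ, nsmul_eq_mul, mul_one] at hsum
  unfold entropy
  rw [← add_div, ← add_div]
  refine div_le_div_of_nonneg_right ?_ (Nat.cast_nonneg _)
  simp only [Finset.sum_sub_distrib]
  linarith

/-- The entropy of a function is at most the logarithm of the size of its codomain. -/
theorem entropy_le_log_card {β : Type*} [Fintype β] [Nonempty Ω] (f : Ω → β) {r : Setoid Ω}
    (h : ∀ ω ω', f ω = f ω' → r ω ω') : entropy r ≤ Real.log (Fintype.card β) := by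
  classical
  have hker : Setoid.ker f ≤ r := fun {ω ω'} h' => h ω ω' h'
  refine (entropy_le_of_le hker).trans ?_
  set s := Setoid.ker f with hs
  have hβ : 0 < (Fintype.card β : ℝ) := by
    exact_mod_cast Fintype.card_pos_iff.2 ⟨f (Classical.arbitrary Ω)⟩
  have hΩ : 0 < (Fintype.card Ω : ℝ) := by exact_mod_cast Fintype.card_pos
  -- Each nonempty fibre of `f` contributes exactly 1 to the sum.
  have hinv : ∑ ω, ((cls s ω).card : ℝ)⁻¹ ≤ Fintype.card β := by
    rw [← Finset.sum_fiberwise Finset.univ f]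
    calc ∑ b, ∑ ω with f ω = b, ((cls s ω).card : ℝ)⁻¹ ≤ ∑ _b : β, (1 : ℝ) := by
          refine Finset.sum_le_sum fun b _ => ?_
          by_cases hb : ∃ ω, f ω = b
          · obtain ⟨ω₀, rfl⟩ := hb
            have hc : (Finset.univ.filter fun ω => f ω = f ω₀) = cls s ω₀ := by
              ext x
              simp [mem_cls, hs, Setoid.ker_def, eq_comm]
            rw [hc, sum_cls_inv]
          · rw [Finset.sum_eq_zero]
            · exact zero_le_one
            · intro ω hω
              exact absurd ⟨ω, (Finset.mem_filter.1 hω).2⟩ hb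
      _ = Fintype.card β := by simp
  have hlog : ∀ ω, Real.log (Fintype.card Ω) - Real.log (cls s ω).card - Real.log (Fintype.card β)
      ≤ (Fintype.card Ω : ℝ) * (Fintype.card β : ℝ)⁻¹ * ((cls s ω).card : ℝ)⁻¹ - 1 := by
    intro ω
    have h1 := card_cls_pos s ω
    have := Real.log_le_sub_one_of_pos
      (x := (Fintype.card Ω : ℝ) * (Fintype.card β : ℝ)⁻¹ * ((cls s ω).card : ℝ)⁻¹) (by positivity)
    rw [Real.log_mul (by positivity) (by positivity), Real.log_mul (by positivity) (by positivity),
      Real.log_inv, Real.log_inv] at this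
    linarith
  have hsum := Finset.sum_le_sum fun ω (_ : ω ∈ Finset.univ) => hlog ω
  rw [Finset.sum_sub_distrib, Finset.sum_sub_distrib, Finset.sum_sub_distrib,
    ← Finset.mul_sum] at hsum
  simp only [Finset.sum_const, Finset.card_univ, nsmul_eq_mul, mul_one] at hsum
  unfold entropy
  rw [div_le_iff₀ hΩ]
  have : (Fintype.card Ω : ℝ) * (Fintype.card β : ℝ)⁻¹ * ∑ ω, ((cls s ω).card : ℝ)⁻¹ ≤
      (Fintype.card Ω : ℝ) * (Fintype.card β : ℝ)⁻¹ * Fintype.card β := by gcongr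
  rw [mul_assoc _ _ (Fintype.card β : ℝ), inv_mul_cancel₀ hβ.ne', mul_one] at this
  rw [Finset.sum_sub_distrib, Finset.sum_const, Finset.card_univ, nsmul_eq_mul]
  linarith

end Entropy

/-! ### Transitivity of permutations on pairs of disjoint sets of given sizes. -/

/-- Two pairs of disjoint sets with the same cardinalities differ by a permutation. -/
theorem exists_perm_map_eq {ι : Type*} [Fintype ι] [DecidableEq ι] {A B A' B' : Finset ι}
    (hd : Disjoint A B) (hd' : Disjoint A' B') (hA : A.card = A'.card) (hB : B.card = B'.card) :
    ∃ τ : Equiv.Perm ι, A.map τ.toEmbedding = A' ∧ B.map τ.toEmbedding = B' := by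
  -- Each pair colours the points by three colours. Equal colour counts let the fibres be matched,
  -- and the matchings glue to a permutation.
  let col : Finset ι → Finset ι → ι → Fin 3 := fun A B i => if i ∈ A then 0 else if i ∈ B then 1 else 2
  have h0 : ∀ (A B : Finset ι) (i : ι), col A B i = 0 ↔ i ∈ A := by
    intro A B i
    simp only [col]
    split_ifs <;> simp_all
  have h1 : ∀ (A B : Finset ι), Disjoint A B → ∀ i : ι, col A B i = 1 ↔ i ∈ B := by
    intro A B h i
    have : i ∈ A → i ∉ B := fun h' => Finset.disjoint_left.1 h h'
    simp only [col]
    split_ifs <;> simp_all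
  have h2 : ∀ (A B : Finset ι) (i : ι), col A B i = 2 ↔ i ∈ (A ∪ B)ᶜ := by
    intro A B i
    simp only [col]
    split_ifs <;> simp_all
  have hcard : ∀ x : Fin 3, Nonempty ({i // col A B i = x} ≃ {i // col A' B' i = x}) := by
    intro x
    rw [← Fintype.card_eq]
    fin_cases x
    · simpa [h0, Fintype.card_subtype] using hA
    · simpa [h1 _ _ hd, h1 _ _ hd', Fintype.card_subtype] using hB
    · simp only [Fin.reduceFinMk, h2]
      simp only [Fintype.card_coe, Finset.card_compl, Finset.card_union_of_disjoint hd,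
        Finset.card_union_of_disjoint hd', hA, hB]
  let τ : Equiv.Perm ι := Equiv.ofFiberEquiv fun x => (hcard x).some
  have hτ : ∀ i, col A' B' (τ i) = col A B i := fun i => Equiv.ofFiberEquiv_map _ i
  refine ⟨τ, ?_, ?_⟩
  · refine Finset.eq_of_subset_of_card_le (fun x hx => ?_) (by simp [hA])
    obtain ⟨i, hi, rfl⟩ := Finset.mem_map.1 hx
    exact (h0 A' B' _).1 ((hτ i).trans ((h0 A B i).2 hi))
  · refine Finset.eq_of_subset_of_card_le (fun x hx => ?_) (by simp [hB])
    obtain ⟨i, hi, rfl⟩ := Finset.mem_map.1 hx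
    exact (h1 A' B' hd' _).1 ((hτ i).trans ((h1 A B hd i).2 hi))

/-! ### Conditional entropies of a code at fixed queries. -/

namespace Code

variable {N K : ℕ} (c : Code N K)

/-- The tuples of all messages. -/
abbrev Msg : Type := Fin K → Fin c.L → c.X

/-- The tuples of queries to all servers. -/
abbrev Queries : Type := ∀ n, c.Qry n

/-- The tuple of queries when message `j` is wanted. -/
def queries (j : Fin K) (ω : c.Ω) : c.Queries := fun n => c.query j n (c.F ω)

theorem measurable_queries (j : Fin K) : Measurable (c.queries j) :=
  measurable_pi_lambda _ fun n => (c.measurable_query j n).comp c.measurable_F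

instance : Nonempty c.X := Fintype.card_pos_iff.1 (by have := c.two_le_card; omega)

theorem one_lt_card : (1 : ℝ) < Fintype.card c.X := by
  have := c.two_le_card
  exact_mod_cast this

theorem log_card_pos : 0 < Real.log (Fintype.card c.X) := Real.log_pos c.one_lt_card

theorem unit_pos : 0 < (c.L : ℝ) * Real.log (Fintype.card c.X) :=
  mul_pos (by exact_mod_cast c.L_pos) c.log_card_pos

/-- Agreement of the first `m` messages. -/
def prefixRel (m : ℕ) : Setoid c.Msg where
  r w w' := ∀ i : Fin K, i.val < m → w i = w' i
  iseqv := ⟨fun _ _ _ => rfl, fun h i hi => (h i hi).symm,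
    fun h h' i hi => (h i hi).trans (h' i hi)⟩

/-- Agreement of the first `m` messages, of the contents of the servers in `A` and of the answers
of the servers in `B` to the queries `q`. -/
def viewRel (m : ℕ) (q : c.Queries) (A B : Finset (Fin N)) : Setoid c.Msg where
  r w w' := (∀ i : Fin K, i.val < m → w i = w' i) ∧ (∀ n ∈ A, c.store n w = c.store n w') ∧
    ∀ n ∈ B, c.answer n (q n) (c.store n w) = c.answer n (q n) (c.store n w')
  iseqv := ⟨fun _ => ⟨fun _ _ => rfl, fun _ _ => rfl, fun _ _ => rfl⟩,
    fun h => ⟨fun i hi => (h.1 i hi).symm, fun n hn => (h.2.1 n hn).symm,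
      fun n hn => (h.2.2 n hn).symm⟩,
    fun h h' => ⟨fun i hi => (h.1 i hi).trans (h'.1 i hi),
      fun n hn => (h.2.1 n hn).trans (h'.2.1 n hn),
      fun n hn => (h.2.2 n hn).trans (h'.2.2 n hn)⟩⟩

theorem prefixRel_iff {m : ℕ} {w w' : c.Msg} :
    c.prefixRel m w w' ↔ ∀ i : Fin K, i.val < m → w i = w' i := Iff.rfl

theorem viewRel_iff {m : ℕ} {q : c.Queries} {A B : Finset (Fin N)} {w w' : c.Msg} :
    c.viewRel m q A B w w' ↔ (∀ i : Fin K, i.val < m → w i = w' i) ∧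
      (∀ n ∈ A, c.store n w = c.store n w') ∧
      ∀ n ∈ B, c.answer n (q n) (c.store n w) = c.answer n (q n) (c.store n w') := Iff.rfl

theorem viewRel_le_prefixRel (m : ℕ) (q : c.Queries) (A B : Finset (Fin N)) :
    c.viewRel m q A B ≤ c.prefixRel m := fun _ _ h => h.1

theorem viewRel_congr (m : ℕ) {q q' : c.Queries} (A : Finset (Fin N)) {B : Finset (Fin N)}
    (h : ∀ n ∈ B, q n = q' n) : c.viewRel m q A B = c.viewRel m q' A B := by
  ext w w'
  simp only [viewRel_iff]
  refine and_congr_right fun _ => and_congr_right fun _ => forall₂_congr fun n hn => ?_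
  rw [h n hn]

/-- The normalized conditional entropy, given the first `m` messages, of the contents of the
servers in `A` and the answers of the servers in `B` to the queries `q`. -/
noncomputable def condEntropy (m : ℕ) (q : c.Queries) (A B : Finset (Fin N)) : ℝ :=
  (entropy (c.viewRel m q A B) - entropy (c.prefixRel m)) /
    (c.L * Real.log (Fintype.card c.X))

theorem condEntropy_nonneg (m : ℕ) (q : c.Queries) (A B : Finset (Fin N)) :
    0 ≤ c.condEntropy m q A B :=
  div_nonneg (sub_nonneg.2 (entropy_le_of_le (c.viewRel_le_prefixRel m q A B))) c.unit_pos.le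

theorem condEntropy_mono (m : ℕ) (q : c.Queries) (A : Finset (Fin N)) {B B' : Finset (Fin N)}
    (h : B ⊆ B') : c.condEntropy m q A B ≤ c.condEntropy m q A B' := by
  refine div_le_div_of_nonneg_right (sub_le_sub_right (entropy_le_of_le ?_) _) c.unit_pos.le
  exact fun _ _ hw => ⟨hw.1, hw.2.1, fun n hn => hw.2.2 n (h hn)⟩

/-- A content determines the answer of its server, so both views also determine the answers from `A₁
∩ B₂` and `A₂ ∩ B₁`. Strong subadditivity is applied with this common part as the coarse partition
`t`. -/
theorem condEntropy_submodular (m : ℕ) (q : c.Queries) (A₁ B₁ A₂ B₂ : Finset (Fin N)) :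
    c.condEntropy m q (A₁ ∪ A₂) ((B₁ ∪ B₂) \ (A₁ ∪ A₂)) +
      c.condEntropy m q (A₁ ∩ A₂) (B₁ ∩ B₂ ∪ A₁ ∩ B₂ ∪ A₂ ∩ B₁) ≤
      c.condEntropy m q A₁ B₁ + c.condEntropy m q A₂ B₂ := by
  unfold condEntropy
  rw [← add_div, ← add_div]
  refine div_le_div_of_nonneg_right ?_ c.unit_pos.le
  have hans : ∀ {w w' : c.Msg} {n : Fin N}, c.store n w = c.store n w' →
      c.answer n (q n) (c.store n w) = c.answer n (q n) (c.store n w') := fun h => by rw [h]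
  have h₁ : c.viewRel m q A₁ B₁ ≤ c.viewRel m q (A₁ ∩ A₂) (B₁ ∩ B₂ ∪ A₁ ∩ B₂ ∪ A₂ ∩ B₁) := by
    intro w w' h
    refine ⟨h.1, fun n hn => h.2.1 n (Finset.mem_inter.1 hn).1, fun n hn => ?_⟩
    simp only [Finset.mem_union, Finset.mem_inter] at hn
    rcases hn with (hn | hn) | hn
    · exact h.2.2 n hn.1
    · exact hans (h.2.1 n hn.1)
    · exact h.2.2 n hn.2
  have h₂ : c.viewRel m q A₂ B₂ ≤ c.viewRel m q (A₁ ∩ A₂) (B₁ ∩ B₂ ∪ A₁ ∩ B₂ ∪ A₂ ∩ B₁) := by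
    intro w w' h
    refine ⟨h.1, fun n hn => h.2.1 n (Finset.mem_inter.1 hn).2, fun n hn => ?_⟩
    simp only [Finset.mem_union, Finset.mem_inter] at hn
    rcases hn with (hn | hn) | hn
    · exact h.2.2 n hn.2
    · exact h.2.2 n hn.2
    · exact hans (h.2.1 n hn.1)
  have h₃ : c.viewRel m q A₁ B₁ ⊓ c.viewRel m q A₂ B₂ ≤
      c.viewRel m q (A₁ ∪ A₂) ((B₁ ∪ B₂) \ (A₁ ∪ A₂)) := by
    rintro w w' ⟨h, h'⟩
    refine ⟨h.1, fun n hn => ?_, fun n hn => ?_⟩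
    · exact (Finset.mem_union.1 hn).elim (h.2.1 n) (h'.2.1 n)
    · exact (Finset.mem_union.1 (Finset.mem_sdiff.1 hn).1).elim (h.2.2 n) (h'.2.2 n)
  have := entropy_inf_add_le h₁ h₂
  have := entropy_le_of_le h₃
  linarith

theorem condEntropy_eq_zero {m : ℕ} (hm : K ≤ m) (q : c.Queries) (A B : Finset (Fin N)) :
    c.condEntropy m q A B = 0 := by
  have h : c.viewRel m q A B = c.prefixRel m := by
    refine le_antisymm (c.viewRel_le_prefixRel m q A B) fun {w w'} hw => ?_
    obtain rfl : w = w' := funext fun i => hw i (i.2.trans_le hm)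
    exact Setoid.refl' _ w
  rw [condEntropy, h, sub_self, zero_div]

/-- A class is a box: the first `m` messages are pinned and the others are free. -/
theorem log_card_cls_prefixRel (m : ℕ) (w : c.Msg) :
    Real.log (cls (c.prefixRel m) w).card =
      ∑ i : Fin K, if i.val < m then 0 else c.L * Real.log (Fintype.card c.X) := by
  classical
  have h : cls (c.prefixRel m) w =
      Fintype.piFinset fun i : Fin K => if i.val < m then {w i} else Finset.univ := by
    ext w'
    rw [mem_cls, prefixRel_iff, Fintype.mem_piFinset]
    refine forall_congr' fun i => ?_
    split_ifs with hi
    · simp [hi, eq_comm]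
    · simp [hi]
  rw [h, Fintype.card_piFinset, Nat.cast_prod, Real.log_prod]
  · refine Finset.sum_congr rfl fun i _ => ?_
    split_ifs <;> simp
  · intro i _
    split_ifs <;> simp

theorem entropy_prefixRel_succ (i : Fin K) :
    entropy (c.prefixRel (i.val + 1)) - entropy (c.prefixRel i.val) =
      c.L * Real.log (Fintype.card c.X) := by
  have hΩ : (Fintype.card c.Msg : ℝ) ≠ 0 := by exact_mod_cast Fintype.card_ne_zero
  have h : (∑ k : Fin K, if k.val < i.val then 0 else c.L * Real.log (Fintype.card c.X)) -
      (∑ k : Fin K, if k.val < i.val + 1 then 0 else c.L * Real.log (Fintype.card c.X)) =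
      c.L * Real.log (Fintype.card c.X) := by
    rw [← Finset.sum_sub_distrib, Finset.sum_eq_single i]
    · simp
    · intro k _ hk
      have : k.val ≠ i.val := fun h => hk (Fin.ext h)
      split_ifs <;> first | omega | simp
    · simp
  unfold entropy
  rw [← sub_div, ← Finset.sum_sub_distrib, div_eq_iff hΩ]
  simp only [log_card_cls_prefixRel, sub_sub_sub_cancel_left, h]
  simp [mul_comm]

theorem entropy_prefixRel_zero : entropy (c.prefixRel 0) = 0 := by
  have : c.prefixRel 0 = ⊤ := by
    ext w w'
    simp [prefixRel_iff, Setoid.top_def]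
  rw [this, entropy_top]

/-- If message `j` can be reconstructed from the answers to `q`, then it accounts for one unit of
the entropy of any view that determines all answers. -/
theorem condEntropy_of_decodable (j : Fin K) (q : c.Queries)
    (hq : ∀ w : c.Msg, c.decode j q (fun n => c.answer n (q n) (c.store n w)) = w j)
    (A B : Finset (Fin N)) (hAB : A ∪ B = Finset.univ) :
    c.condEntropy j.val q A B = 1 + c.condEntropy (j.val + 1) q A B := by
  -- The view already determines message `j`, so conditioning on it changes only the subtracted
  -- prefix entropy, by one unit.
  have h : c.viewRel j.val q A B = c.viewRel (j.val + 1) q A B := by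
    refine le_antisymm (fun {w w'} hw => ⟨fun i hi => ?_, hw.2⟩)
      fun {w w'} hw => ⟨fun i hi => hw.1 i (hi.trans (Nat.lt_succ_self _)), hw.2⟩
    rcases Nat.lt_succ_iff_lt_or_eq.1 hi with hi | hi
    · exact hw.1 i hi
    · obtain rfl : i = j := Fin.ext hi
      rw [← hq w, ← hq w']
      congr 1
      funext n
      have hn : n ∈ A ∪ B := hAB ▸ Finset.mem_univ n
      rcases Finset.mem_union.1 hn with hn | hn
      · rw [hw.2.1 n hn]
      · exact hw.2.2 n hn
  unfold condEntropy
  rw [h, ← div_self c.unit_pos.ne', ← add_div]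
  congr 1
  have := c.entropy_prefixRel_succ j
  have hu := div_self c.unit_pos.ne'
  linarith

/-- Correctness concerns only the realized message tuple. Since each `w` has positive probability
and is independent of the key, a set of queries that fails for `w` must itself be null; there are
finitely many `w`. -/
theorem ae_decodable (j : Fin K) : ∀ᵐ ω ∂c.P, ∀ w : c.Msg,
    c.decode j (c.queries j ω) (fun n => c.answer n (c.queries j ω n) (c.store n w)) = w j := by
  rw [ae_all_iff]
  intro w
  let bad : Set c.Queries := {q | c.decode j q (fun n => c.answer n (q n) (c.store n w)) ≠ w j}
  have hbad : MeasurableSet bad := bad.to_countable.measurableSet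
  have hkey : Measurable fun f n => c.query j n f := measurable_pi_lambda _ (c.measurable_query j)
  have hind := c.indep.measure_inter_preimage_eq_mul _ _ (hkey hbad) (measurableSet_singleton w)
  have hzero : c.P (c.F ⁻¹' ((fun f n => c.query j n f) ⁻¹' bad) ∩ c.W ⁻¹' {w}) = 0 := by
    refine measure_mono_null ?_ (ae_iff.1 (c.correct j))
    rintro ω ⟨h, rfl⟩
    exact h
  have hpos : c.P (c.W ⁻¹' {w}) ≠ 0 := by
    rw [c.uniform_W]
    exact ENNReal.inv_ne_zero.2 (ENNReal.pow_ne_top (ENNReal.natCast_ne_top _))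
  rw [hzero] at hind
  rw [ae_iff]
  exact (mul_eq_zero.1 hind.symm).resolve_right hpos

/-! ### Averaging over the key. -/

/-- The normalized conditional entropy, given the key and the first `m` messages, when message `j`
is wanted. -/
noncomputable def keyEntropy (m : ℕ) (j : Fin K) (A B : Finset (Fin N)) : ℝ :=
  ∫ ω, c.condEntropy m (c.queries j ω) A B ∂c.P

theorem integrable_condEntropy (m : ℕ) (j : Fin K) (A B : Finset (Fin N)) :
    Integrable (fun ω => c.condEntropy m (c.queries j ω) A B) c.P := by
  have hmeas : Measurable fun q : c.Queries => c.condEntropy m q A B := measurable_of_countable _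
  refine Integrable.of_bound (hmeas.comp (c.measurable_queries j)).aestronglyMeasurable
    (Real.log (Fintype.card c.Msg) / (c.L * Real.log (Fintype.card c.X))) (ae_of_all _ fun ω => ?_)
  rw [Real.norm_of_nonneg (c.condEntropy_nonneg _ _ _ _)]
  refine div_le_div_of_nonneg_right ?_ c.unit_pos.le
  have h₁ := entropy_nonneg (c.prefixRel m)
  have h₂ := entropy_le_log_card id (r := c.viewRel m (c.queries j ω) A B)
    fun w w' h => by obtain rfl : w = w' := h; exact Setoid.refl' _ w
  linarith

theorem keyEntropy_nonneg (m : ℕ) (j : Fin K) (A B : Finset (Fin N)) :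
    0 ≤ c.keyEntropy m j A B := integral_nonneg fun _ => c.condEntropy_nonneg _ _ _ _

theorem keyEntropy_mono (m : ℕ) (j : Fin K) (A : Finset (Fin N)) {B B' : Finset (Fin N)}
    (h : B ⊆ B') : c.keyEntropy m j A B ≤ c.keyEntropy m j A B' :=
  integral_mono (c.integrable_condEntropy m j A B) (c.integrable_condEntropy m j A B')
    fun _ => c.condEntropy_mono m _ A h

theorem keyEntropy_submodular (m : ℕ) (j : Fin K) (A₁ B₁ A₂ B₂ : Finset (Fin N)) :
    c.keyEntropy m j (A₁ ∪ A₂) ((B₁ ∪ B₂) \ (A₁ ∪ A₂)) +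
      c.keyEntropy m j (A₁ ∩ A₂) (B₁ ∩ B₂ ∪ A₁ ∩ B₂ ∪ A₂ ∩ B₁) ≤
      c.keyEntropy m j A₁ B₁ + c.keyEntropy m j A₂ B₂ := by
  unfold keyEntropy
  rw [← integral_add (c.integrable_condEntropy ..) (c.integrable_condEntropy ..),
    ← integral_add (c.integrable_condEntropy ..) (c.integrable_condEntropy ..)]
  exact integral_mono ((c.integrable_condEntropy ..).add (c.integrable_condEntropy ..))
    ((c.integrable_condEntropy ..).add (c.integrable_condEntropy ..))
    fun _ => c.condEntropy_submodular m _ A₁ B₁ A₂ B₂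

theorem keyEntropy_eq_zero {m : ℕ} (hm : K ≤ m) (j : Fin K) (A B : Finset (Fin N)) :
    c.keyEntropy m j A B = 0 := by
  simp [keyEntropy, c.condEntropy_eq_zero hm]

theorem keyEntropy_decodable (j : Fin K) (A B : Finset (Fin N)) (hAB : A ∪ B = Finset.univ) :
    c.keyEntropy j.val j A B = 1 + c.keyEntropy (j.val + 1) j A B := by
  have h : c.keyEntropy j.val j A B =
      ∫ ω, (1 + c.condEntropy (j.val + 1) (c.queries j ω) A B) ∂c.P := by
    refine integral_congr_ae ?_
    filter_upwards [c.ae_decodable j] with ω hω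
    exact c.condEntropy_of_decodable j _ hω A B hAB
  rw [h, integral_add (integrable_const _) (c.integrable_condEntropy ..)]
  simp [keyEntropy]

theorem keyEntropy_empty (m : ℕ) (j j' : Fin K) (A : Finset (Fin N)) :
    c.keyEntropy m j A ∅ = c.keyEntropy m j' A ∅ := by
  refine integral_congr_ae (ae_of_all _ fun ω => ?_)
  simp only [condEntropy]
  rw [c.viewRel_congr m A (B := ∅) (q' := c.queries j' ω) (by simp)]

theorem map_query_eq (n : Fin N) (j j' : Fin K) :
    c.P.map (fun ω => c.query j n (c.F ω)) = c.P.map (fun ω => c.query j' n (c.F ω)) := by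
  have hm : ∀ j, Measurable fun ω => c.query j n (c.F ω) := fun j =>
    (c.measurable_query j n).comp c.measurable_F
  refine Measure.ext_of_singleton fun q => ?_
  rw [Measure.map_apply (hm j) (measurableSet_singleton q),
    Measure.map_apply (hm j') (measurableSet_singleton q)]
  exact c.privacy n j j' q

/-- The integrand is a function of the query to server `n` alone, and privacy fixes the law of that
query. -/
theorem keyEntropy_singleton (m : ℕ) (j j' : Fin K) (A : Finset (Fin N)) (n : Fin N) :
    c.keyEntropy m j A {n} = c.keyEntropy m j' A {n} := by
  classical
  obtain ⟨ω₀⟩ : Nonempty c.Ω := c.P.nonempty_of_neZero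
  -- An arbitrary filler for the queries to the other servers, which do not affect the view.
  let q₀ : c.Queries := c.queries j ω₀
  have hm : ∀ j, Measurable fun ω => c.query j n (c.F ω) := fun j =>
    (c.measurable_query j n).comp c.measurable_F
  let g : c.Qry n → ℝ := fun q => c.condEntropy m (Function.update q₀ n q) A {n}
  have hg : Measurable g := measurable_of_countable _
  have h : ∀ i, c.keyEntropy m i A {n} = ∫ q, g q ∂(c.P.map fun ω => c.query i n (c.F ω)) := by
    intro i
    rw [integral_map (hm i).aemeasurable hg.aestronglyMeasurable]
    refine integral_congr_ae (ae_of_all _ fun ω => ?_)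
    simp only [condEntropy, g]
    rw [c.viewRel_congr m A (B := {n}) (q' := Function.update q₀ n (c.query i n (c.F ω)))]
    intro k hk
    obtain rfl := Finset.mem_singleton.1 hk
    simp [queries]
  rw [h, h, c.map_query_eq n j j']

theorem keyEntropy_storage_le (j : Fin K) (n : Fin N) :
    c.keyEntropy 0 j {n} ∅ ≤ Real.logb (Fintype.card c.X) (Fintype.card (c.Sto n)) / c.L := by
  have h : ∀ ω, c.condEntropy 0 (c.queries j ω) {n} ∅ ≤
      Real.logb (Fintype.card c.X) (Fintype.card (c.Sto n)) / c.L := by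
    intro ω
    rw [condEntropy, entropy_prefixRel_zero, sub_zero, Real.logb, div_div, mul_comm (Real.log _)]
    refine div_le_div_of_nonneg_right (entropy_le_log_card (c.store n) fun w w' hw => ?_)
      c.unit_pos.le
    simpa [viewRel_iff] using hw
  calc c.keyEntropy 0 j {n} ∅ ≤
      ∫ _, Real.logb (Fintype.card c.X) (Fintype.card (c.Sto n)) / c.L ∂c.P :=
        integral_mono (c.integrable_condEntropy ..) (integrable_const _) h
    _ = _ := by simp

theorem keyEntropy_download_le (j : Fin K) (n : Fin N) :
    c.keyEntropy 0 j ∅ {n} ≤ Real.logb (Fintype.card c.X) (Fintype.card c.Y) / c.L *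
      ∫ ω, (c.len n (c.query j n (c.F ω)) : ℝ) ∂c.P := by
  rw [← integral_const_mul]
  refine integral_mono (c.integrable_condEntropy ..) ((c.integrable_len j n).const_mul _)
    fun ω => ?_
  have hu := c.unit_pos
  have hlog := c.log_card_pos
  have hL : (0 : ℝ) < c.L := by exact_mod_cast c.L_pos
  have h : entropy (c.viewRel 0 (c.queries j ω) ∅ {n}) ≤
      c.len n (c.query j n (c.F ω)) * Real.log (Fintype.card c.Y) := by
    classical
    refine (entropy_le_log_card
      (fun w => c.answer n (c.queries j ω n) (c.store n w)) fun w w' hw => ?_).trans_eq ?_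
    · simpa [viewRel_iff] using hw
    · rw [Fintype.card_pi_const, Nat.cast_pow, Real.log_pow]
      rfl
  simp only [condEntropy, entropy_prefixRel_zero, sub_zero]
  rw [div_le_iff₀ hu, Real.logb]
  refine h.trans_eq ?_
  field_simp

end Code

/-! ### Concave sequences and cardinalities of sets of servers. -/

/-- A concave sequence with nonnegative initial term has decreasing averages. -/
theorem mul_le_mul_of_concave {z : ℕ → ℝ} {N : ℕ} (h0 : 0 ≤ z 0)
    (hz : ∀ b, b + 2 ≤ N → z (b + 2) + z b ≤ z (b + 1) + z (b + 1)) {b : ℕ} (hb : 1 ≤ b)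
    (hbN : b ≤ N) : b * z N ≤ N * z b := by
  -- Consecutive averages are compared in a form free of division, so that `b = 0` is a valid base
  -- case: there it is `0 ≤ z 0`.
  have hstep : ∀ b, b + 1 ≤ N → (b : ℝ) * z (b + 1) ≤ (b + 1) * z b := by
    intro b
    induction b with
    | zero => intro _; simpa using h0
    | succ b ih =>
      intro h
      have h1 := ih (by omega)
      have h2 := mul_le_mul_of_nonneg_left (hz b h) (by positivity : (0 : ℝ) ≤ b + 1)
      push_cast
      linarith
  have hall : ∀ M, b ≤ M → M ≤ N → (b : ℝ) * z M ≤ M * z b := by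
    intro M hM
    induction M, hM using Nat.le_induction with
    | base => intro _; exact le_rfl
    | succ M hM ih =>
      intro h
      have hMpos : (0 : ℝ) < M := by exact_mod_cast (by omega : 0 < M)
      have h1 := mul_le_mul_of_nonneg_left (hstep M h) (Nat.cast_nonneg (α := ℝ) b)
      have h2 := mul_le_mul_of_nonneg_left (ih (by omega)) (by positivity : (0 : ℝ) ≤ M + 1)
      refine le_of_mul_le_mul_left ?_ hMpos
      push_cast
      linarith
  exact hall N hbN le_rfl

theorem exists_disjoint_card {N a b : ℕ} (h : a + b ≤ N) :
    ∃ A B : Finset (Fin N), Disjoint A B ∧ A.card = a ∧ B.card = b := by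
  obtain ⟨A, -, hA⟩ := Finset.exists_subset_card_eq (s := (Finset.univ : Finset (Fin N))) (n := a)
    (by simp; omega)
  obtain ⟨B, hB, hB'⟩ := Finset.exists_subset_card_eq (s := Aᶜ) (n := b)
    (by rw [Finset.card_compl, Fintype.card_fin]; omega)
  exact ⟨A, B, Finset.disjoint_left.2 fun i hi hi' => Finset.mem_compl.1 (hB hi') hi, hA, hB'⟩

theorem card_inter_union_inter_union_inter {ι : Type*} [DecidableEq ι] {A₁ B₁ A₂ B₂ : Finset ι}
    (h₁ : A₁ ∩ B₁ = ∅) (h₂ : A₂ ∩ B₂ = ∅) : (B₁ ∩ B₂ ∪ A₁ ∩ B₂ ∪ A₂ ∩ B₁).card =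
      (B₁ ∩ B₂).card + (A₁ ∩ B₂).card + (A₂ ∩ B₁).card := by
  rw [Finset.card_union_of_disjoint, Finset.card_union_of_disjoint]
  all_goals
    rw [Finset.disjoint_left]
    intro i
    have hn₁ : i ∈ A₁ → i ∉ B₁ := fun h h' =>
      Finset.notMem_empty i (h₁ ▸ Finset.mem_inter.2 ⟨h, h'⟩)
    have hn₂ : i ∈ A₂ → i ∉ B₂ := fun h h' =>
      Finset.notMem_empty i (h₂ ▸ Finset.mem_inter.2 ⟨h, h'⟩)
    simp only [Finset.mem_inter, Finset.mem_union]
    tauto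

/-! ### Symmetrization over the servers. -/

namespace Code

variable {N K : ℕ} (c : Code N K)

/-- The conditional entropy averaged over all permutations of the servers. -/
noncomputable def avgEntropy (m : ℕ) (j : Fin K) (A B : Finset (Fin N)) : ℝ :=
  (∑ σ : Equiv.Perm (Fin N), c.keyEntropy m j (A.map σ.toEmbedding) (B.map σ.toEmbedding)) /
    Fintype.card (Equiv.Perm (Fin N))

theorem avgEntropy_map (m : ℕ) (j : Fin K) (A B : Finset (Fin N)) (τ : Equiv.Perm (Fin N)) :
    c.avgEntropy m j (A.map τ.toEmbedding) (B.map τ.toEmbedding) = c.avgEntropy m j A B := by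
  unfold avgEntropy
  congr 1
  refine Fintype.sum_equiv (Equiv.mulRight τ) _ _ fun σ => ?_
  rw [Finset.map_map, Finset.map_map]
  rfl

theorem avgEntropy_le {m m' : ℕ} {j j' : Fin K} {A B A' B' : Finset (Fin N)}
    (h : ∀ σ : Equiv.Perm (Fin N), c.keyEntropy m j (A.map σ.toEmbedding) (B.map σ.toEmbedding) ≤
      c.keyEntropy m' j' (A'.map σ.toEmbedding) (B'.map σ.toEmbedding)) :
    c.avgEntropy m j A B ≤ c.avgEntropy m' j' A' B' :=
  div_le_div_of_nonneg_right (Finset.sum_le_sum fun σ _ => h σ) (Nat.cast_nonneg _)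

open Classical in
/-- The symmetrized conditional entropy of the contents of `a` servers and the answers of `b`
further servers; zero if there are not enough servers. -/
noncomputable def sizeEntropy (m : ℕ) (j : Fin K) (a b : ℕ) : ℝ :=
  if h : ∃ p : Finset (Fin N) × Finset (Fin N), Disjoint p.1 p.2 ∧ p.1.card = a ∧ p.2.card = b then
    c.avgEntropy m j h.choose.1 h.choose.2 else 0

/-- The representatives chosen in `sizeEntropy` do not matter: any two differ by a permutation,
which the average absorbs. -/
theorem sizeEntropy_card (m : ℕ) (j : Fin K) {A B : Finset (Fin N)} (hd : Disjoint A B) {a b : ℕ}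
    (ha : A.card = a) (hb : B.card = b) : c.sizeEntropy m j a b = c.avgEntropy m j A B := by
  have h : ∃ p : Finset (Fin N) × Finset (Fin N),
    Disjoint p.1 p.2 ∧ p.1.card = a ∧ p.2.card = b := ⟨(A, B), hd, ha, hb⟩
  obtain ⟨hd', ha', hb'⟩ := h.choose_spec
  obtain ⟨τ, h₁, h₂⟩ := exists_perm_map_eq hd hd' (ha.trans ha'.symm) (hb.trans hb'.symm)
  rw [sizeEntropy, dif_pos h, ← h₁, ← h₂, avgEntropy_map]

theorem sizeEntropy_nonneg (m : ℕ) (j : Fin K) (a b : ℕ) : 0 ≤ c.sizeEntropy m j a b := by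
  unfold sizeEntropy
  split_ifs
  · exact div_nonneg (Finset.sum_nonneg fun _ _ => c.keyEntropy_nonneg ..) (Nat.cast_nonneg _)
  · exact le_rfl

theorem sizeEntropy_submodular (m : ℕ) (j : Fin K) {A₁ B₁ A₂ B₂ : Finset (Fin N)}
    (h₁ : A₁ ∩ B₁ = ∅) (h₂ : A₂ ∩ B₂ = ∅) :
    c.sizeEntropy m j (A₁ ∪ A₂).card ((B₁ ∪ B₂) \ (A₁ ∪ A₂)).card +
      c.sizeEntropy m j (A₁ ∩ A₂).card ((B₁ ∩ B₂).card + (A₁ ∩ B₂).card + (A₂ ∩ B₁).card) ≤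
      c.sizeEntropy m j A₁.card B₁.card + c.sizeEntropy m j A₂.card B₂.card := by
  have hn₁ : ∀ i, i ∈ A₁ → i ∉ B₁ := fun i h h' =>
    Finset.notMem_empty i (h₁ ▸ Finset.mem_inter.2 ⟨h, h'⟩)
  have hn₂ : ∀ i, i ∈ A₂ → i ∉ B₂ := fun i h h' =>
    Finset.notMem_empty i (h₂ ▸ Finset.mem_inter.2 ⟨h, h'⟩)
  have hd : Disjoint (A₁ ∩ A₂) (B₁ ∩ B₂ ∪ A₁ ∩ B₂ ∪ A₂ ∩ B₁) := by
    rw [Finset.disjoint_left]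
    intro i
    have := hn₁ i
    have := hn₂ i
    simp only [Finset.mem_inter, Finset.mem_union]
    tauto
  rw [c.sizeEntropy_card m j Finset.disjoint_sdiff rfl rfl, 
    c.sizeEntropy_card m j hd rfl (card_inter_union_inter_union_inter h₁ h₂),
    c.sizeEntropy_card m j (Finset.disjoint_iff_inter_eq_empty.2 h₁) rfl rfl,
    c.sizeEntropy_card m j (Finset.disjoint_iff_inter_eq_empty.2 h₂) rfl rfl]
  unfold avgEntropy
  rw [← add_div, ← add_div, ← Finset.sum_add_distrib, ← Finset.sum_add_distrib]
  refine div_le_div_of_nonneg_right (Finset.sum_le_sum fun σ _ => ?_) (Nat.cast_nonneg _)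
  have := c.keyEntropy_submodular m j (A₁.map σ.toEmbedding) (B₁.map σ.toEmbedding)
    (A₂.map σ.toEmbedding) (B₂.map σ.toEmbedding)
  simpa only [Finset.map_union, Finset.map_inter, Finset.map_sdiff] using this

theorem sizeEntropy_mono (m : ℕ) (j : Fin K) {a b : ℕ} (h : a + (b + 1) ≤ N) :
    c.sizeEntropy m j a b ≤ c.sizeEntropy m j a (b + 1) := by
  obtain ⟨A, B, hd, hA, hB⟩ := exists_disjoint_card h
  obtain ⟨B', hB', hc⟩ := Finset.exists_subset_card_eq (s := B) (n := b) (by omega)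
  rw [c.sizeEntropy_card m j hd hA hB,
    c.sizeEntropy_card m j (hd.mono_right hB') hA hc]
  exact c.avgEntropy_le fun σ => c.keyEntropy_mono m j _ (Finset.map_subset_map.2 hB')

theorem sizeEntropy_eq_zero {m : ℕ} (hm : K ≤ m) (j : Fin K) (a b : ℕ) :
    c.sizeEntropy m j a b = 0 := by
  unfold sizeEntropy avgEntropy
  simp [c.keyEntropy_eq_zero hm]

theorem sizeEntropy_decodable (j : Fin K) {a : ℕ} (h : a ≤ N) :
    c.sizeEntropy j.val j a (N - a) = 1 + c.sizeEntropy (j.val + 1) j a (N - a) := by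
  obtain ⟨A, B, hd, hA, hB⟩ := exists_disjoint_card (by omega : a + (N - a) ≤ N)
  have hu : A ∪ B = Finset.univ := by
    rw [← Finset.card_eq_iff_eq_univ, Finset.card_union_of_disjoint hd, hA, hB, Fintype.card_fin]
    omega
  have hpos : (Fintype.card (Equiv.Perm (Fin N)) : ℝ) ≠ 0 := by exact_mod_cast Fintype.card_ne_zero
  rw [c.sizeEntropy_card _ j hd hA hB, c.sizeEntropy_card _ j hd hA hB]
  unfold avgEntropy
  rw [← div_self hpos, ← add_div]
  congr 1
  rw [Finset.sum_congr rfl fun σ _ => c.keyEntropy_decodable j (A.map σ.toEmbedding)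
    (B.map σ.toEmbedding) (by rw [← Finset.map_union, hu, Finset.map_univ_equiv]),
    Finset.sum_add_distrib]
  simp

/-- Concavity in `b` is submodularity for the answers of `U \ {i}` and `U \ {i'}`, where `U` has `b
+ 2` elements. -/
theorem sizeEntropy_han (m : ℕ) (j : Fin K) {b : ℕ} (hb : 1 ≤ b) (hbN : b ≤ N) :
    b * c.sizeEntropy m j 0 N ≤ N * c.sizeEntropy m j 0 b := by
  refine mul_le_mul_of_concave (z := fun b => c.sizeEntropy m j 0 b)
    (c.sizeEntropy_nonneg m j 0 0) (fun b hb => ?_) hb hbN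
  obtain ⟨U, -, hU⟩ := Finset.exists_subset_card_eq (s := (Finset.univ : Finset (Fin N)))
    (n := b + 2) (by simpa using hb)
  obtain ⟨i, hi, i', hi', hne⟩ := Finset.one_lt_card.1 (by omega : 1 < U.card)
  have h1 : (U.erase i).card = b + 1 := by rw [Finset.card_erase_of_mem hi]; omega
  have h2 : (U.erase i').card = b + 1 := by rw [Finset.card_erase_of_mem hi']; omega
  have h3 : U.erase i ∪ U.erase i' = U := by
    ext x
    simp only [Finset.mem_union, Finset.mem_erase]
    by_cases hx : x = i
    · subst hx; tauto
    · tauto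
  have h4 : (U.erase i ∩ U.erase i').card = b := by
    have := Finset.card_union_add_card_inter (U.erase i) (U.erase i')
    rw [h3] at this
    omega
  have := c.sizeEntropy_submodular m j (A₁ := ∅) (A₂ := ∅) (B₁ := U.erase i) (B₂ := U.erase i')
    (by simp) (by simp)
  rw [h1, h2, h3, h4] at this
  simpa [hU] using this

theorem sizeEntropy_zero_right (m : ℕ) (j j' : Fin K) (a : ℕ) :
    c.sizeEntropy m j a 0 = c.sizeEntropy m j' a 0 := by
  by_cases h : a ≤ N
  · obtain ⟨A, B, hd, hA, hB⟩ := exists_disjoint_card (by omega : a + 0 ≤ N)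
    obtain rfl := Finset.card_eq_zero.1 hB
    rw [c.sizeEntropy_card _ j hd hA hB, c.sizeEntropy_card _ j' hd hA hB]
    unfold avgEntropy
    simp only [Finset.map_empty, c.keyEntropy_empty m j j']
  · have hn : ¬ ∃ p : Finset (Fin N) × Finset (Fin N),
        Disjoint p.1 p.2 ∧ p.1.card = a ∧ p.2.card = 0 := by
      rintro ⟨p, -, hp, -⟩
      exact h (hp ▸ (Finset.card_le_univ p.1).trans_eq (Fintype.card_fin N))
    rw [sizeEntropy, sizeEntropy, dif_neg hn, dif_neg hn]

theorem sizeEntropy_one_right (m : ℕ) (j j' : Fin K) {a : ℕ} (h : a + 1 ≤ N) :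
    c.sizeEntropy m j a 1 = c.sizeEntropy m j' a 1 := by
  obtain ⟨A, B, hd, hA, hB⟩ := exists_disjoint_card h
  obtain ⟨n, rfl⟩ := Finset.card_eq_one.1 hB
  rw [c.sizeEntropy_card _ j hd hA hB, c.sizeEntropy_card _ j' hd hA hB]
  unfold avgEntropy
  simp only [Finset.map_singleton, c.keyEntropy_singleton m j j']

/-- Composing with a transposition shows that the sum over `σ` is the same at every point. This
turns the symmetrized entropy of one server into the average over servers that defines the costs. -/
theorem sum_perm_apply {ι : Type*} [Fintype ι] [DecidableEq ι] (φ : ι → ℝ) (i : ι) :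
    (∑ σ : Equiv.Perm ι, φ (σ i)) / Fintype.card (Equiv.Perm ι) =
      (∑ k, φ k) / Fintype.card ι := by
  have hpos : (Fintype.card (Equiv.Perm ι) : ℝ) ≠ 0 := by exact_mod_cast Fintype.card_ne_zero
  have hι : (Fintype.card ι : ℝ) ≠ 0 := by
    have : Nonempty ι := ⟨i⟩
    exact_mod_cast Fintype.card_ne_zero
  have h : ∀ k, ∑ σ : Equiv.Perm ι, φ (σ k) = ∑ σ : Equiv.Perm ι, φ (σ i) := fun k =>
    Fintype.sum_equiv (Equiv.mulRight (Equiv.swap i k)) _ _ fun σ => by simp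
  have h' : ∑ k, ∑ σ : Equiv.Perm ι, φ (σ k) = Fintype.card (Equiv.Perm ι) * ∑ k, φ k := by
    rw [Finset.sum_comm, Finset.sum_congr rfl fun σ _ => Equiv.sum_comp σ φ]
    simp
  rw [Finset.sum_congr rfl fun k _ => h k, Finset.sum_const, Finset.card_univ, nsmul_eq_mul] at h'
  rw [div_eq_div_iff hpos hι]
  linarith

theorem sizeEntropy_storage_le (hN : 1 ≤ N) (j : Fin K) :
    c.sizeEntropy 0 j 1 0 ≤ c.storageCost := by
  rw [c.sizeEntropy_card 0 j (A := {⟨0, hN⟩}) (B := ∅) (by simp) (by simp) (by simp)]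
  simp only [avgEntropy, Finset.map_singleton, Finset.map_empty]
  refine (sum_perm_apply (fun n => c.keyEntropy 0 j {n} ∅) _).trans_le ?_
  refine (div_le_div_of_nonneg_right (Finset.sum_le_sum fun n _ => c.keyEntropy_storage_le j n)
    (Nat.cast_nonneg _)).trans_eq ?_
  rw [storageCost, ← Finset.sum_div, Fintype.card_fin, div_div, one_div_mul_eq_div, mul_comm]

theorem sizeEntropy_download_le (hN : 1 ≤ N) (j : Fin K) :
    c.sizeEntropy 0 j 0 1 ≤ c.downloadCost j := by
  rw [c.sizeEntropy_card 0 j (A := ∅) (B := {⟨0, hN⟩}) (by simp) (by simp) (by simp)]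
  simp only [avgEntropy, Finset.map_singleton, Finset.map_empty]
  refine (sum_perm_apply (fun n => c.keyEntropy 0 j ∅ {n}) _).trans_le ?_
  refine (div_le_div_of_nonneg_right (Finset.sum_le_sum fun n _ => c.keyEntropy_download_le j n)
    (Nat.cast_nonneg _)).trans_eq ?_
  rw [downloadCost, ← Finset.mul_sum, Fintype.card_fin, mul_div_right_comm, div_div,
    mul_comm (c.L : ℝ)]

/-- The values of the variables of the linear program given by a code. -/
noncomputable def assignment : Var → ℝ
  -- Messages are numbered from 1 in the program and from 0 in `Fin K`. At `x_k` and `y_{k+1}` the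
  -- same `k` messages are conditioned on and only the wanted message differs. The default 0 keeps
  -- variables outside the program nonnegative.
  | .x k a b => if h : k - 1 < K then c.sizeEntropy k ⟨k - 1, h⟩ a b else 0
  | .y k a b => if h : k - 1 < K then c.sizeEntropy (k - 1) ⟨k - 1, h⟩ a b else 0

theorem assignment_nonneg (i : Var) : 0 ≤ c.assignment i := by
  cases i <;> simp only [assignment] <;> split_ifs <;>
    first | exact c.sizeEntropy_nonneg .. | exact le_rfl

theorem assignment_x {k : ℕ} (h : k < K) (a b : ℕ) :
    c.assignment (.x (k + 1) a b) = c.sizeEntropy (k + 1) ⟨k, h⟩ a b := by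
  simp [assignment, h]

theorem assignment_y {k : ℕ} (h : k < K) (a b : ℕ) :
    c.assignment (.y (k + 1) a b) = c.sizeEntropy k ⟨k, h⟩ a b := by
  simp [assignment, h]

end Code

/-! ### Feasibility of the assignment and the bound on the optimum. -/

theorem LinConstraint.holds_false {f : Var →₀ ℝ} {r : ℝ} {v : Var → ℝ} :
    LinConstraint.Holds ⟨false, f, r⟩ v ↔ r ≤ Finsupp.linearCombination ℝ v f := Iff.rfl

theorem LinConstraint.holds_true {f : Var →₀ ℝ} {r : ℝ} {v : Var → ℝ} :
    LinConstraint.Holds ⟨true, f, r⟩ v ↔ Finsupp.linearCombination ℝ v f = r := Iff.rfl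

theorem linearCombination_form (v : Var → ℝ) (i : Var) :
    Finsupp.linearCombination ℝ v (form i) = v i := by
  simp [form]

theorem holds_submodularity {N : ℕ} {z : ℕ → ℕ → Var} {A₁ B₁ A₂ B₂ : Finset (Fin N)}
    {v : Var → ℝ} : (submodularity z A₁ B₁ A₂ B₂).Holds v ↔
      v (z (A₁ ∪ A₂).card ((B₁ ∪ B₂) \ (A₁ ∪ A₂)).card) +
      v (z (A₁ ∩ A₂).card ((B₁ ∩ B₂).card + (A₁ ∩ B₂).card + (A₂ ∩ B₁).card)) ≤
      v (z A₁.card B₁.card) + v (z A₂.card B₂.card) := by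
  rw [submodularity, LinConstraint.holds_false]
  simp only [map_sub, map_add, linearCombination_form]
  constructor <;> intro h <;> linarith

theorem Code.assignment_mem_feasible {N K : ℕ} (c : Code N K) (hN : 1 ≤ N) (hK : 1 ≤ K) :
    c.assignment ∈ feasible N K := by
  intro d hd
  cases hd with
  | submodular_x k hk A₁ B₁ A₂ B₂ h₁ h₂ =>
    obtain ⟨k, rfl⟩ := Nat.exists_eq_add_of_le' hk.1
    rw [holds_submodularity]
    simp only [c.assignment_x (by omega : k < K)]
    exact c.sizeEntropy_submodular _ _ h₁ h₂
  | submodular_y k hk A₁ B₁ A₂ B₂ h₁ h₂ =>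
    obtain ⟨k, rfl⟩ := Nat.exists_eq_add_of_le' hk.1
    rw [holds_submodularity]
    simp only [c.assignment_y (by omega : k < K)]
    exact c.sizeEntropy_submodular _ _ h₁ h₂
  | monotone_x k a b hk ha hb =>
    obtain ⟨k, rfl⟩ := Nat.exists_eq_add_of_le' hk.1
    obtain ⟨b, rfl⟩ := Nat.exists_eq_add_of_le' hb.1
    rw [LinConstraint.holds_false, map_sub, linearCombination_form, linearCombination_form,
      c.assignment_x (by omega), c.assignment_x (by omega), sub_nonneg]
    exact c.sizeEntropy_mono _ _ (by omega)
  | monotone_y k a b hk ha hb =>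
    obtain ⟨k, rfl⟩ := Nat.exists_eq_add_of_le' hk.1
    obtain ⟨b, rfl⟩ := Nat.exists_eq_add_of_le' hb.1
    rw [LinConstraint.holds_false, map_sub, linearCombination_form, linearCombination_form,
      c.assignment_y (by omega), c.assignment_y (by omega), sub_nonneg]
    exact c.sizeEntropy_mono _ _ (by omega)
  | decodable k a hk ha =>
    obtain ⟨k, rfl⟩ := Nat.exists_eq_add_of_le' hk.1
    rw [LinConstraint.holds_false, map_sub, linearCombination_form, linearCombination_form,
      c.assignment_x (by omega), c.assignment_y (by omega)]
    have := c.sizeEntropy_decodable ⟨k, by omega⟩ (by omega : a ≤ N)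
    linarith
  | han k b hk hb =>
    obtain ⟨k, rfl⟩ := Nat.exists_eq_add_of_le' hk.1
    have hN' : (0 : ℝ) < N := by exact_mod_cast hN
    rw [LinConstraint.holds_false, map_sub, map_smul, linearCombination_form,
      linearCombination_form, c.assignment_y (by omega), c.assignment_y (by omega), sub_nonneg,
      smul_eq_mul, div_mul_eq_mul_div, div_le_iff₀ hN', mul_comm _ (N : ℝ)]
    exact c.sizeEntropy_han _ _ hb.1 (by omega)
  | privacy k a hk ha =>
    obtain ⟨k, rfl⟩ := Nat.exists_eq_add_of_le' hk.1
    rw [LinConstraint.holds_true, map_sub, linearCombination_form, linearCombination_form,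
      c.assignment_x (by omega), c.assignment_y (by omega), sub_eq_zero]
    exact c.sizeEntropy_one_right _ _ _ (by omega)
  | invariance k a hk ha =>
    obtain ⟨k, rfl⟩ := Nat.exists_eq_add_of_le' hk.1
    rw [LinConstraint.holds_true, map_sub, linearCombination_form, linearCombination_form,
      c.assignment_x (by omega), c.assignment_y (by omega), sub_eq_zero]
    exact c.sizeEntropy_zero_right _ _ _ _
  | boundary a b ha hb =>
    obtain ⟨k, rfl⟩ := Nat.exists_eq_add_of_le' hK
    rw [LinConstraint.holds_true, linearCombination_form, c.assignment_x (by omega)]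
    exact c.sizeEntropy_eq_zero le_rfl _ _ _

theorem optimum_nonneg_le {N K : ℕ} (hN : 1 ≤ N) (hK : 1 ≤ K) {α β : ℝ}
    (h : Achievable N K α β) {a₀ b₀ : ℝ} (ha : 0 ≤ a₀) (hb : 0 ≤ b₀) :
    optimum (feasible N K ∩ {v | ∀ i, 0 ≤ v i}) a₀ b₀ ≤ ((a₀ * α + b₀ * β : ℝ) : EReal) := by
  obtain ⟨c, hα, hβ⟩ := h
  refine (iInf₂_le c.assignment
    ⟨c.assignment_mem_feasible hN hK, c.assignment_nonneg⟩).trans ?_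
  rw [EReal.coe_le_coe_iff, objective]
  refine add_le_add (mul_le_mul_of_nonneg_left ?_ ha) (mul_le_mul_of_nonneg_left ?_ hb)
  · rw [c.assignment_y (k := 0) hK]
    exact (c.sizeEntropy_storage_le hN _).trans hα
  · rw [c.assignment_y (k := 0) hK]
    exact (c.sizeEntropy_download_le hN _).trans (hβ _)

theorem optimum_anti {s t : Set (Var → ℝ)} (h : s ⊆ t) (a₀ b₀ : ℝ) :
    optimum t a₀ b₀ ≤ optimum s a₀ b₀ := biInf_mono fun _ hv => h hv

/-! ### Counting the constraints. -/

section Count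

/-- The four-term constraint `z(p₀,p₁) + z(p₂,p₃) ≥ z(p₄,p₅) + z(p₆,p₇)`. -/
noncomputable def fourTerm (z : ℕ → ℕ → Var) (p : Fin 8 → ℕ) : LinConstraint where
  isEq := false
  coeff := form (z (p 0) (p 1)) + form (z (p 2) (p 3)) - form (z (p 4) (p 5)) -
    form (z (p 6) (p 7))
  const := 0

open Var in
/-- A parametrization of a family of constraints containing those of the linear program: `t` is
the kind of constraint, `k + 1` the index of the message, and `p` the sizes that occur in it. -/
noncomputable def constraintOf (N K : ℕ) (t : Fin 9) (k : ℕ) (p : Fin 8 → ℕ) : LinConstraint :=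
  match t with
  | 0 => fourTerm (x (k + 1)) p
  | 1 => fourTerm (y (k + 1)) p
  | 2 => ⟨false, form (x (k + 1) (p 0) (p 1)) - form (x (k + 1) (p 0) (p 1 - 1)), 0⟩
  | 3 => ⟨false, form (y (k + 1) (p 0) (p 1)) - form (y (k + 1) (p 0) (p 1 - 1)), 0⟩
  | 4 => ⟨false, form (y (k + 1) (p 0) (N - p 0)) - form (x (k + 1) (p 0) (N - p 0)), 1⟩
  | 5 => ⟨false, form (y (k + 1) 0 (p 0)) - ((p 0 : ℝ) / N) • form (y (k + 1) 0 N), 0⟩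
  | 6 => ⟨true, form (x (k + 1) (p 0) 1) - form (y (k + 1 + 1) (p 0) 1), 0⟩
  | 7 => ⟨true, form (x (k + 1) (p 0) 0) - form (y (k + 1 + 1) (p 0) 0), 0⟩
  | 8 => ⟨true, form (x K (p 0) (p 1)), 0⟩

/-- A submodularity constraint sees its four sets only through eight sizes. Disjointness makes the
three-term sum the size of a union, hence at most `N`. -/
theorem exists_submodularity_eq_fourTerm {N : ℕ} {A₁ B₁ A₂ B₂ : Finset (Fin N)}
    (h₁ : A₁ ∩ B₁ = ∅) (h₂ : A₂ ∩ B₂ = ∅) : ∃ p : Fin 8 → ℕ, (∀ i, p i ≤ N) ∧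
      ∀ z, submodularity z A₁ B₁ A₂ B₂ = fourTerm z p := by
  have hle : ∀ A : Finset (Fin N), A.card ≤ N := fun A =>
    (Finset.card_le_univ A).trans_eq (Fintype.card_fin N)
  have hle' : (B₁ ∩ B₂).card + (A₁ ∩ B₂).card + (A₂ ∩ B₁).card ≤ N :=
    card_inter_union_inter_union_inter h₁ h₂ ▸ hle _
  refine ⟨![A₁.card, B₁.card, A₂.card, B₂.card, (A₁ ∪ A₂).card, ((B₁ ∪ B₂) \ (A₁ ∪ A₂)).card,
    (A₁ ∩ A₂).card, (B₁ ∩ B₂).card + (A₁ ∩ B₂).card + (A₂ ∩ B₁).card], ?_, fun _ => rfl⟩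
  simp [Fin.forall_fin_succ, hle, hle']

theorem exists_constraintOf {N K : ℕ} (hN : 1 ≤ N) (hK : 1 ≤ K) {d : LinConstraint}
    (hd : IsConstraint N K d) :
    ∃ t, ∃ k < K, ∃ p : Fin 8 → ℕ, (∀ i, p i ≤ N) ∧ d = constraintOf N K t k p := by
  have hpair : ∀ {a b : ℕ}, a ≤ N → b ≤ N →
      ∀ i, (fun i : Fin 8 => if i = 0 then a else b) i ≤ N := fun ha hb i => by
    simp only
    split_ifs <;> assumption
  cases hd with
  | submodular_x k hk A₁ B₁ A₂ B₂ h₁ h₂ =>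
    obtain ⟨k, rfl⟩ := Nat.exists_eq_add_of_le' hk.1
    obtain ⟨p, hp, h⟩ := exists_submodularity_eq_fourTerm (A₂ := A₂) h₁ h₂
    exact ⟨0, k, by omega, p, hp, h _⟩
  | submodular_y k hk A₁ B₁ A₂ B₂ h₁ h₂ =>
    obtain ⟨k, rfl⟩ := Nat.exists_eq_add_of_le' hk.1
    obtain ⟨p, hp, h⟩ := exists_submodularity_eq_fourTerm (A₂ := A₂) h₁ h₂
    exact ⟨1, k, by omega, p, hp, h _⟩
  | monotone_x k a b hk ha hb =>
    obtain ⟨k, rfl⟩ := Nat.exists_eq_add_of_le' hk.1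
    exact ⟨2, k, by omega, _, hpair (a := a) (b := b) (by omega) (by omega), rfl⟩
  | monotone_y k a b hk ha hb =>
    obtain ⟨k, rfl⟩ := Nat.exists_eq_add_of_le' hk.1
    exact ⟨3, k, by omega, _, hpair (a := a) (b := b) (by omega) (by omega), rfl⟩
  | decodable k a hk ha =>
    obtain ⟨k, rfl⟩ := Nat.exists_eq_add_of_le' hk.1
    exact ⟨4, k, by omega, fun _ => a, fun _ => (by omega : a ≤ N), rfl⟩
  | han k b hk hb =>
    obtain ⟨k, rfl⟩ := Nat.exists_eq_add_of_le' hk.1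
    exact ⟨5, k, by omega, fun _ => b, fun _ => (by omega : b ≤ N), rfl⟩
  | privacy k a hk ha =>
    obtain ⟨k, rfl⟩ := Nat.exists_eq_add_of_le' hk.1
    exact ⟨6, k, by omega, fun _ => a, fun _ => (by omega : a ≤ N), rfl⟩
  | invariance k a hk ha =>
    obtain ⟨k, rfl⟩ := Nat.exists_eq_add_of_le' hk.1
    exact ⟨7, k, by omega, fun _ => a, fun _ => (by omega : a ≤ N), rfl⟩
  | boundary a b ha hb =>
    exact ⟨8, 0, hK, _, hpair (a := a) (b := b) (by omega) (by omega), rfl⟩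

theorem finite_and_ncard_constraints_le {N K : ℕ} (hN : 1 ≤ N) (hK : 1 ≤ K) :
    {d | IsConstraint N K d}.Finite ∧
      {d | IsConstraint N K d}.ncard ≤ 9 * 2 ^ 8 * (K * N ^ 8) := by
  classical
  let S : Finset (Fin 9 × ℕ × (Fin 8 → ℕ)) := Finset.univ ×ˢ Finset.range K ×ˢ
    Fintype.piFinset fun _ : Fin 8 => Finset.range (N + 1)
  let T : Finset LinConstraint := S.image fun s => constraintOf N K s.1 s.2.1 s.2.2
  have hsub : {d | IsConstraint N K d} ⊆ (T : Set LinConstraint) := by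
    intro d hd
    obtain ⟨t, k, hk, p, hp, rfl⟩ := exists_constraintOf hN hK hd
    refine Finset.mem_coe.2 (Finset.mem_image.2 ⟨(t, k, p), ?_, rfl⟩)
    simp only [S, Finset.mem_product, Finset.mem_univ, Finset.mem_range, Fintype.mem_piFinset,
      true_and]
    exact ⟨hk, fun i => Nat.lt_succ_of_le (hp i)⟩
  have hS : S.card = 9 * (K * (N + 1) ^ 8) := by
    simp [S, Finset.card_product]
  refine ⟨T.finite_toSet.subset hsub, ?_⟩
  calc {d | IsConstraint N K d}.ncard ≤ (T : Set LinConstraint).ncard :=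
        Set.ncard_le_ncard hsub T.finite_toSet
    _ = T.card := Set.ncard_coe_finset T
    _ ≤ 9 * (K * (N + 1) ^ 8) := hS ▸ Finset.card_image_le
    -- `N + 1 ≤ 2 * N` because `N ≥ 1`; this is the source of the factor `2 ^ 8`.
    _ ≤ 9 * (K * (2 * N) ^ 8) := by gcongr; omega
    _ = 9 * 2 ^ 8 * (K * N ^ 8) := by ring

end Count

end PIR

theorem proposition2 :
    (∀ (N K : ℕ), 1 ≤ N → 1 ≤ K → ∀ (α β : ℝ), PIR.Achievable N K α β →
      ∀ (a₀ b₀ : ℝ), 0 ≤ a₀ → 0 ≤ b₀ →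
        PIR.optimum (PIR.feasible N K) a₀ b₀ ≤ ((a₀ * α + b₀ * β : ℝ) : EReal) ∧
        PIR.optimum (PIR.feasible N K ∩ {v | ∀ i, 0 ≤ v i}) a₀ b₀ ≤
          ((a₀ * α + b₀ * β : ℝ) : EReal)) ∧
    (∃ C : ℕ, ∀ (N K : ℕ), 1 ≤ N → 1 ≤ K →
      {c | PIR.IsConstraint N K c}.Finite ∧
      {c | PIR.IsConstraint N K c}.ncard ≤ C * (K * N ^ 8)) := by
  refine ⟨fun N K hN hK α β h a₀ b₀ ha hb => ?_, 9 * 2 ^ 8, fun N K hN hK =>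
    PIR.finite_and_ncard_constraints_le hN hK⟩
  have := PIR.optimum_nonneg_le hN hK h ha hb
  exact ⟨(PIR.optimum_anti Set.inter_subset_left a₀ b₀).trans this, this⟩
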